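/- Let $n\ge 1$, let $\overline{\mathbb D}$ be the closed unit disk in $\mathbb C$ and $\mathbb T$ the unit circle, and let $\mathbb Z_+=\{0,1,2,\dots\}$. For $(p,q)\in\mathbb Z^2$ define the scattering polynomial $\varphi^{(p,q)}:\mathbb C\to\mathbb C$ by \[ \varphi^{(p,q)}(\zeta)=\frac{(-1)^p}{q\,(p+q-1)!}\,(1-\zeta\bar\zeta)\,\frac{\partial^{p+q}}{\partial\bar\zeta^{p}\,\partial\zeta^{q}}(1-\zeta\bar\zeta)^{p+q-1}\qquad\text{if }\min\{p,q\}\ge 1, \] $\varphi^{(p,0)}(\zeta)=\zeta^p$ if $p\ge 0$, and $\varphi^{(p,q)}=0$ if $\min\{p,q\}<0$ or $p=0<q$. For $w\in\overline{\mathbb D}$, $z\in\mathbb T$ and $v\in\overline{\mathbb D}$ let \[ \Psi^{w}_{z}(v)=z\,\frac{v+w}{1+\overline{w}\,v}, \] where for $|w|=1$ this is understood as the constant function $\Psi^w_z(v)=zw$. For $w\in\overline{\mathbb D}^n$ and $z\in\mathbb T^n$ put \[ \Psi(w,z)=\Psi^{w_1}_{z_1}\circ\cdots\circ\Psi^{w_n}_{z_n}(0).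 \] For $k\in\mathbb Z^n$ write $z^k=z_1^{k_1}\cdots z_n^{k_n}$, and put $k_{n+1}=0$. Then for every $w\in\overline{\mathbb D}^n$ the function $z\mapsto\Psi(w,z)$ is continuous on $\mathbb T^n$, and its Fourier series is \[ \Psi(w,z)=\sum_{k\in\{1\}\times\mathbb Z_+^{n-1}}\Bigl(\prod_{j=1}^n\varphi^{(k_j,k_{j+1})}(w_j)\Bigr)z^k . \] That is, the $k$-th Fourier coefficient of $\Psi(w,\cdot)$ equals $\prod_{j=1}^n\varphi^{(k_j,k_{j+1})}(w_j)$ if $k\in\{1\}\times\mathbb Z_+^{n-1}$ and equals $0$ for every other $k\in\mathbb Z^n$; and for every $z\in\mathbb T^n$ the series converges absolutely to $\Psi(w,z)$. -/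

import Mathlib

noncomputable section

namespace Scattering

/-- The Wirtinger derivative `∂/∂ζ = (∂/∂x - i ∂/∂y) / 2` of a function of `ζ = x + i y`. -/
def dzeta (f : ℂ → ℂ) (ζ : ℂ) : ℂ :=
  (fderiv ℝ f ζ 1 - Complex.I * fderiv ℝ f ζ Complex.I) / 2

/-- The Wirtinger derivative `∂/∂ζ̄ = (∂/∂x + i ∂/∂y) / 2` of a function of `ζ = x + i y`. -/
def dzetaBar (f : ℂ → ℂ) (ζ : ℂ) : ℂ :=
  (fderiv ℝ f ζ 1 + Complex.I * fderiv ℝ f ζ Complex.I) / 2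

/-- The scattering polynomial `φ^{(p,q)}`. For `p, q ≥ 1` it is given by the Rodrigues-type formula
`(-1)^p / (q (p+q-1)!) * (1 - ζ ζ̄) * ∂^{p+q}/∂ζ̄^p∂ζ^q (1 - ζ ζ̄)^{p+q-1}`;
moreover `φ^{(p,0)}(ζ) = ζ^p` for `p ≥ 0`; in the remaining cases
(`min p q < 0`, or `p = 0 < q`) it is zero. -/
def scatteringPoly (p q : ℤ) (ζ : ℂ) : ℂ :=
  if 1 ≤ min p q then
    (-1) ^ p.toNat / ((q : ℂ) * ((p + q - 1).toNat.factorial : ℂ)) *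
      (1 - ζ * starRingEnd ℂ ζ) *
      (dzetaBar^[p.toNat] (dzeta^[q.toNat]
        (fun η : ℂ => (1 - η * starRingEnd ℂ η) ^ (p + q - 1).toNat))) ζ
  else if 0 ≤ p ∧ q = 0 then ζ ^ p.toNat
  else 0

/-- The map `Ψ^w_z(v) = z (v + w) / (1 + w̄ v)`, which for `|w| = 1` is the constant `z w`.
(For `|w| = 1` the quotient is `0 / 0` at `v = -w`; the constant value is used there too.) -/
def diskMap (w : ℂ) (z : Circle) (v : ℂ) : ℂ :=
  if ‖w‖ = 1 then z * w else z * ((v + w) / (1 + starRingEnd ℂ w * v))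

/-- `Ψ(w, z) = (Ψ^{w_1}_{z_1} ∘ ⋯ ∘ Ψ^{w_n}_{z_n}) (0)`. -/
def diskComp {n : ℕ} (w : Fin n → ℂ) (z : Fin n → Circle) : ℂ :=
  ((List.ofFn fun j => diskMap (w j) (z j)).foldr (fun f g => f ∘ g) id) 0

/-- The entry `k_{j+1}` following `k_j`, with the convention `k_{n+1} = 0`. -/
def nextEntry {n : ℕ} (k : Fin n → ℤ) (j : Fin n) : ℤ :=
  if h : (j : ℕ) + 1 < n then k ⟨j + 1, h⟩ else 0

/-- `Φ(w, k) = ∏_{j=1}^n φ^{(k_j, k_{j+1})}(w_j)`, where `k_{n+1} = 0`. -/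
def scatteringProd {n : ℕ} (w : Fin n → ℂ) (k : Fin n → ℤ) : ℂ :=
  ∏ j, scatteringPoly (k j) (nextEntry k j) (w j)

/-- The index set `{1} × ℤ_+^{n-1}`, as a subset of `ℤ^n`. -/
def latticeIndex (n : ℕ) [NeZero n] : Set (Fin n → ℤ) :=
  {k | k 0 = 1 ∧ ∀ j, 0 ≤ k j}

/-- `Ψ(w, ·)` as a function on `(ℝ/ℤ)^n`, through `z_j = exp (2 π i t_j)`. -/
def diskCompTorus {n : ℕ} (w : Fin n → ℂ) (t : UnitAddTorus (Fin n)) : ℂ :=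
  diskComp w (fun j => AddCircle.toCircle (t j))

end Scattering

end

open scoped ComplexConjugate

namespace Scattering

/-! For `‖w‖ < 1`, `scatteringPoly p q w` is the `q`-th Taylor coefficient at `0` of the `p`-th
power of `(v + w) / (1 + conj w * v)` (`iteratedDeriv_moebius_pow`): the Rodrigues formula and the
derivative of that power expand to the same finite sum. Hence `diskComp w z ^ p` is a power series
in the composition over the remaining coordinates, and iterating this produces the product of
scattering polynomials, linked because the exponent `q` at one coordinate is the power `p` at the
next. The theorem is the case `p = 1`.

Rearranging the iterated sums needs absolute convergence. Cauchy estimates on a circle of radius `R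
> 1` give `‖scatteringPoly p q w‖ ≤ ρ ^ p / R ^ q` with `ρ > 1` arbitrary
(`norm_scatteringPoly_le`), a bound that survives induction on the coordinates
(`summable_norm_scatteringProd`). The series then converges uniformly on the torus, so its
coefficients are the Fourier coefficients. -/

/-! ### Wirtinger derivatives and the Rodrigues formula. -/

theorem dzeta_eq_of_hasFDerivAt {f : ℂ → ℂ} {a b ζ : ℂ}
    (h : HasFDerivAt f (a • (ContinuousLinearMap.id ℝ ℂ) +
      b • (Complex.conjCLE : ℂ →L[ℝ] ℂ)) ζ) : dzeta f ζ = a := by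
  simp only [dzeta, h.fderiv]
  simp
  linear_combination (a * (-1/2) + b / 2) * Complex.I_mul_I

theorem dzetaBar_eq_of_hasFDerivAt {f : ℂ → ℂ} {a b ζ : ℂ}
    (h : HasFDerivAt f (a • (ContinuousLinearMap.id ℝ ℂ) +
      b • (Complex.conjCLE : ℂ →L[ℝ] ℂ)) ζ) : dzetaBar f ζ = b := by
  simp only [dzetaBar, h.fderiv]
  simp
  linear_combination (a * (1/2) - b / 2) * Complex.I_mul_I

theorem hasFDerivAt_conj_complex (ζ : ℂ) :
    HasFDerivAt (fun η : ℂ => conj η) (Complex.conjCLE : ℂ →L[ℝ] ℂ) ζ :=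
  (Complex.conjCLE : ℂ →L[ℝ] ℂ).hasFDerivAt

theorem dzeta_conj_pow_mul_pow (c : ℂ) (a m : ℕ) :
    dzeta (fun η : ℂ => c * (conj η ^ a * (1 - η * conj η) ^ (m + 1))) =
      fun η : ℂ => (-(m + 1) * c) * (conj η ^ (a + 1) * (1 - η * conj η) ^ m) := by
  funext ζ
  have h1 := hasFDerivAt_conj_complex ζ
  have h2 := (((h1.pow a).mul (((hasFDerivAt_id ζ).mul h1).const_sub 1 |>.pow (m + 1))).const_mul c)
  refine dzeta_eq_of_hasFDerivAt (b := c * (a * conj ζ ^ (a - 1) * (1 - ζ * conj ζ) ^ (m + 1)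
    - conj ζ ^ a * ((m + 1) * (1 - ζ * conj ζ) ^ m * ζ))) (h2.congr_fderiv ?_)
  ext1 v
  simp
  ring

theorem iterate_dzeta_one_sub (m q : ℕ) :
    dzeta^[q] (fun η : ℂ => (1 - η * conj η) ^ (m + q)) =
      fun η : ℂ => ((-1) ^ q * ((m + q).descFactorial q : ℂ)) *
        (conj η ^ q * (1 - η * conj η) ^ m) := by
  have key : ∀ i m : ℕ, dzeta^[i] (fun η : ℂ => (1 - η * conj η) ^ (m + i)) =
      fun η : ℂ => ((-1) ^ i * ((m + i).descFactorial i : ℂ)) *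
        (conj η ^ i * (1 - η * conj η) ^ m) := by
    intro i
    induction i with
    | zero => intro m; simp
    | succ i ih =>
      intro m
      rw [Function.iterate_succ_apply', show m + (i + 1) = (m + 1) + i by ring, ih (m + 1),
        dzeta_conj_pow_mul_pow]
      funext η
      rw [Nat.descFactorial_succ, show m + 1 + i - i = m + 1 by omega]
      push_cast
      ring
  exact key q m

theorem iterate_dzetaBar_monomial_sum {ι : Type*} (s : Finset ι) (c : ι → ℂ) (a b : ι → ℕ)
    (p : ℕ) :
    dzetaBar^[p] (fun η : ℂ => ∑ i ∈ s, c i * (η ^ a i * conj η ^ b i)) =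
      fun η : ℂ => ∑ i ∈ s, (c i * ((b i).descFactorial p : ℂ)) *
        (η ^ a i * conj η ^ (b i - p)) := by
  induction p with
  | zero => simp
  | succ p ih =>
    rw [Function.iterate_succ_apply', ih]
    funext ζ
    have h1 := hasFDerivAt_conj_complex ζ
    have h2 := HasFDerivAt.fun_sum (u := s) fun i _ =>
      (((hasFDerivAt_id ζ).pow (a i)).mul (h1.pow (b i - p))).const_mul
        (c i * ((b i).descFactorial p : ℂ))
    refine dzetaBar_eq_of_hasFDerivAt
      (a := ∑ i ∈ s, (c i * ((b i).descFactorial p : ℂ)) * (a i * ζ ^ (a i - 1) *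
        conj ζ ^ (b i - p))) (h2.congr_fderiv ?_)
    ext1 v
    simp only [add_apply, sum_apply,
      smul_apply, ContinuousLinearMap.id_apply, smul_eq_mul,
      Finset.sum_mul, ← Finset.sum_add_distrib]
    refine Finset.sum_congr rfl fun i _ => ?_
    simp [Nat.descFactorial_succ, Nat.sub_sub]
    ring

theorem scatteringPoly_zero_right (p : ℕ) (w : ℂ) : scatteringPoly p 0 w = w ^ p := by
  simp [scatteringPoly]

theorem scatteringPoly_zero_succ (q : ℕ) (w : ℂ) :
    scatteringPoly 0 ((q + 1 : ℕ) : ℤ) w = 0 := by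
  have : ¬ ((q : ℤ) + 1 = 0) := by omega
  simp [scatteringPoly, this]

/-- The factor `q + 1` on the left is the one produced by differentiating `v ^ (q + 1)`. Where `q +
i - p` truncates, the binomial coefficient vanishes. -/
theorem scatteringPoly_succ_succ (p q : ℕ) (w : ℂ) :
    scatteringPoly ((p + 1 : ℕ) : ℤ) ((q + 1 : ℕ) : ℤ) w * (q + 1) =
      (p + 1) * (1 - w * conj w) * ∑ i ∈ Finset.range (p + 1),
        (p.choose i : ℂ) * w ^ i *
          (((q + 1 + i).choose (p + 1) : ℂ) * (-conj w) ^ (q + i - p)) := by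
  have h0 : (1 : ℤ) ≤ min ((p + 1 : ℕ) : ℤ) ((q + 1 : ℕ) : ℤ) := by simp
  have h1 : (((p + 1 : ℕ) : ℤ) + ((q + 1 : ℕ) : ℤ) - 1).toNat = p + (q + 1) := by omega
  have h2 : (fun η : ℂ => ((-1) ^ (q + 1) * ((p + (q + 1)).descFactorial (q + 1) : ℂ)) *
        (conj η ^ (q + 1) * (1 - η * conj η) ^ p)) =
      fun η : ℂ => ∑ i ∈ Finset.range (p + 1),
        ((-1) ^ (q + 1) * ((p + (q + 1)).descFactorial (q + 1) : ℂ) * (-1) ^ i * p.choose i) *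
          (η ^ i * conj η ^ (q + 1 + i)) := by
    funext η
    rw [sub_eq_neg_add, add_pow, Finset.mul_sum, Finset.mul_sum]
    refine Finset.sum_congr rfl fun i _ => ?_
    rw [neg_pow]
    ring
  rw [scatteringPoly, if_pos h0, h1, Int.toNat_natCast, Int.toNat_natCast,
    iterate_dzeta_one_sub, h2, iterate_dzetaBar_monomial_sum]
  have h3 : ((p + (q + 1)).descFactorial (q + 1) : ℂ) * p.factorial = (p + (q + 1)).factorial := by
    have := Nat.factorial_mul_descFactorial (show q + 1 ≤ p + (q + 1) by omega)
    rw [show p + (q + 1) - (q + 1) = p by omega] at this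
    rw [mul_comm]; exact_mod_cast this
  have h4 : ((p + (q + 1)).factorial : ℂ) ≠ 0 := by exact_mod_cast Nat.factorial_ne_zero _
  have h5 : (q + 1 : ℂ) ≠ 0 := by exact_mod_cast Nat.succ_ne_zero q
  have hp : (p.factorial : ℂ) ≠ 0 := by exact_mod_cast Nat.factorial_ne_zero _
  rw [Finset.mul_sum, Finset.mul_sum, Finset.sum_mul]
  refine Finset.sum_congr rfl fun i _ => ?_
  rw [Nat.descFactorial_eq_factorial_mul_choose (q + 1 + i) (p + 1),
    show q + 1 + i - (p + 1) = q + i - p by omega]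
  by_cases hc : q + i < p
  · rw [Nat.choose_eq_zero_of_lt (show q + 1 + i < p + 1 by omega)]
    simp
  · have hs : (-1 : ℂ) ^ (p + 1) * (-1) ^ (q + 1) * (-1) ^ i = (-1) ^ (q + i - p) := by
      obtain ⟨d, hd⟩ := Nat.exists_eq_add_of_le (not_lt.mp hc)
      rw [← pow_add, ← pow_add, hd, Nat.add_sub_cancel_left,
        show p + 1 + (q + 1) + i = 2 * (p + 1) + d by omega, pow_add, pow_mul]
      simp
    rw [neg_pow (conj w), ← hs, ← h3, Nat.factorial_succ]
    rw [← h3] at h4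
    have h6 := left_ne_zero_of_mul h4
    push_cast
    field_simp

theorem scatteringPoly_succ_succ_of_norm_eq_one (p q : ℕ) {w : ℂ} (hw : ‖w‖ = 1) :
    scatteringPoly ((p + 1 : ℕ) : ℤ) ((q + 1 : ℕ) : ℤ) w = 0 := by
  have h := scatteringPoly_succ_succ p q w
  have h5 : (q + 1 : ℂ) ≠ 0 := by exact_mod_cast Nat.succ_ne_zero q
  rw [Complex.mul_conj, Complex.normSq_eq_norm_sq, hw] at h
  simpa [h5] using h

/-! ### Taylor coefficients of powers of disk automorphisms. -/

theorem iteratedDeriv_zero_of_hasSum {g : ℂ → ℂ} {d : ℕ → ℂ} {r : ℝ} (hr : 0 < r)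
    (h : ∀ v ∈ Metric.ball (0 : ℂ) r, HasSum (fun q => d q * v ^ q) (g v)) (q : ℕ) :
    iteratedDeriv q g 0 = q.factorial * d q := by
  have h1 : HasFPowerSeriesAt g (FormalMultilinearSeries.ofScalars ℂ d) 0 := by
    rw [hasFPowerSeriesAt_iff]
    filter_upwards [Metric.ball_mem_nhds (0 : ℂ) hr] with v hv
    simpa [FormalMultilinearSeries.coeff_ofScalars, mul_comm] using h v hv
  have h2 := congrArg (fun p => FormalMultilinearSeries.coeff p q)
    (h1.analyticAt.hasFPowerSeriesAt.eq_formalMultilinearSeries h1)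
  simp only [FormalMultilinearSeries.coeff_ofScalars] at h2
  have h3 : (q.factorial : ℂ) ≠ 0 := by exact_mod_cast Nat.factorial_ne_zero _
  rw [← h2]
  field_simp

/-- Binomial theorem for the numerator, negative binomial series for the denominator; the `i`-th
summand is a series shifted by `p - i`. -/
theorem hasSum_add_pow_div_pow (p : ℕ) {w x v : ℂ} (h : ‖x * v‖ < 1) :
    HasSum (fun q : ℕ => (∑ i ∈ Finset.range (p + 1),
        (p.choose i : ℂ) * w ^ i *
          (((q + 1 + i).choose (p + 1) : ℂ) * x ^ (q + i - p))) * v ^ q)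
      ((v + w) ^ p / (1 - x * v) ^ (p + 2)) := by
  have key : ∀ i ∈ Finset.range (p + 1), HasSum (fun q : ℕ => (p.choose i : ℂ) * w ^ i *
          (((q + 1 + i).choose (p + 1) : ℂ) * x ^ (q + i - p)) * v ^ q)
      ((p.choose i : ℂ) * w ^ i * v ^ (p - i) * (1 / (1 - x * v) ^ (p + 2))) := by
    intro i hi
    have hip : i ≤ p := Nat.lt_succ_iff.mp (Finset.mem_range.mp hi)
    have h1 := (hasSum_choose_mul_geometric_of_norm_lt_one (p + 1) h).mul_left
      ((p.choose i : ℂ) * w ^ i * v ^ (p - i))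
    rw [← (add_left_injective (p - i)).hasSum_iff]
    · refine h1.congr_fun fun j => ?_
      simp only [Function.comp_apply]
      rw [show j + (p - i) + 1 + i = j + (p + 1) by omega, show j + (p - i) + i - p = j by omega,
        mul_pow, pow_add]
      ring
    · intro q hq
      have : q + 1 + i < p + 1 := by
        by_contra hc
        exact hq ⟨q - (p - i), by simp only []; omega⟩
      simp [Nat.choose_eq_zero_of_lt this]
  convert! hasSum_sum key using 1
  · funext q
    rw [Finset.sum_mul]
  · rw [add_comm v w, add_pow, Finset.sum_div]
    refine Finset.sum_congr rfl fun i _ => ?_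
    ring

theorem one_add_conj_mul_ne_zero {w v : ℂ} (h : ‖w‖ * ‖v‖ < 1) : 1 + conj w * v ≠ 0 := by
  intro h0
  have h1 : ‖conj w * v‖ = 1 := by
    rw [eq_neg_of_add_eq_zero_right h0]
    simp
  rw [norm_mul, RCLike.norm_conj] at h1
  linarith

theorem norm_moebius_le_one {w v : ℂ} (hw : ‖w‖ < 1) (hv : ‖v‖ ≤ 1) :
    ‖(v + w) / (1 + conj w * v)‖ ≤ 1 := by
  rw [norm_div]
  refine div_le_one_of_le₀ ?_ (norm_nonneg _)
  rw [← sq_le_sq₀ (norm_nonneg _) (norm_nonneg _), ← Complex.normSq_eq_norm_sq,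
    ← Complex.normSq_eq_norm_sq]
  have h1 : Complex.normSq w ≤ 1 := by
    rw [Complex.normSq_eq_norm_sq]; exact pow_le_one₀ (norm_nonneg _) hw.le
  have h2 : Complex.normSq v ≤ 1 := by
    rw [Complex.normSq_eq_norm_sq]; exact pow_le_one₀ (norm_nonneg _) hv
  simp only [Complex.normSq_apply, Complex.add_re, Complex.add_im, Complex.mul_re, Complex.mul_im,
    Complex.conj_re, Complex.conj_im, Complex.one_re, Complex.one_im] at *
  -- `|1 + w̄v|² - |v + w|² = (1 - |w|²)(1 - |v|²)`.
  nlinarith [mul_nonneg (sub_nonneg.mpr h1) (sub_nonneg.mpr h2)]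

theorem iteratedDeriv_moebius_pow (p q : ℕ) {w : ℂ} (hw : ‖w‖ < 1) :
    iteratedDeriv q (fun v : ℂ => ((v + w) / (1 + conj w * v)) ^ p) 0 =
      q.factorial * scatteringPoly p q w := by
  rcases p with _ | p
  · rcases q with _ | q
    · simpa using (scatteringPoly_zero_right 0 w).symm
    · have := scatteringPoly_zero_succ q w
      simp only [pow_zero, Nat.cast_zero, this, mul_zero]
      simp [iteratedDeriv_const]
  rcases q with _ | q
  · have := scatteringPoly_zero_right (p + 1) w
    simp only [Nat.cast_zero, this]
    simp
  have hlt : ∀ v ∈ Metric.ball (0 : ℂ) 1, ‖w‖ * ‖v‖ < 1 := fun v hv => by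
    have : ‖v‖ < 1 := by simpa using hv
    nlinarith [norm_nonneg w, norm_nonneg v]
  have hd : deriv (fun v : ℂ => ((v + w) / (1 + conj w * v)) ^ (p + 1)) =ᶠ[nhds 0]
      fun v => ((p + 1) * (1 - w * conj w)) *
        ((v + w) ^ p / (1 - (-conj w) * v) ^ (p + 2)) := by
    filter_upwards [Metric.ball_mem_nhds (0 : ℂ) one_pos] with v hv
    have hne := one_add_conj_mul_ne_zero (hlt v hv)
    have h1 := ((((hasDerivAt_id v).add_const w).div
      (((hasDerivAt_id v).const_mul (conj w)).const_add 1) hne).pow (p + 1))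
    refine HasDerivAt.deriv (h1.congr_deriv ?_)
    have hne' : 1 + v * conj w ≠ 0 := by rwa [mul_comm v]
    simp only [id, neg_mul, sub_neg_eq_add, mul_one, Nat.cast_add, Nat.cast_one,
      Nat.add_sub_cancel, div_pow, Pi.div_apply]
    field_simp
    ring
  rw [iteratedDeriv_succ', hd.iteratedDeriv_eq, iteratedDeriv_zero_of_hasSum one_pos
    (d := fun q => ((p + 1) * (1 - w * conj w)) * (∑ i ∈ Finset.range (p + 1),
        (p.choose i : ℂ) * w ^ i *
          (((q + 1 + i).choose (p + 1) : ℂ) * (-conj w) ^ (q + i - p))))]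
  · rw [← scatteringPoly_succ_succ, Nat.factorial_succ]
    push_cast
    ring
  · intro v hv
    have h1 := (hasSum_add_pow_div_pow p (w := w) (x := -conj w) (v := v)
      (by simpa using hlt v hv)).mul_left ((p + 1) * (1 - w * conj w))
    exact h1.congr_fun fun q => by ring

/-! ### Cauchy estimates beyond the unit disk. -/

/-- The closed unit disk is compact and is mapped into itself, so by continuity a slightly larger
disk lands in radius `ρ`. -/
theorem exists_radius_norm_moebius_le {w : ℂ} (hw : ‖w‖ < 1) {ρ : ℝ} (hρ : 1 < ρ) :
    ∃ R : ℝ, 1 < R ∧ ∀ v : ℂ, ‖v‖ ≤ R →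
      ‖w‖ * ‖v‖ < 1 ∧ ‖(v + w) / (1 + conj w * v)‖ ≤ ρ := by
  set U : Set ℂ := {v | ‖w‖ * ‖v‖ < 1}
  have hU : IsOpen U := isOpen_lt (by fun_prop) continuous_const
  have hc : ContinuousOn (fun v : ℂ => ‖(v + w) / (1 + conj w * v)‖) U :=
    (ContinuousOn.div (by fun_prop) (by fun_prop)
      fun v hv => one_add_conj_mul_ne_zero hv).norm
  have hV := hc.isOpen_inter_preimage hU (isOpen_Iio (a := ρ))
  have hsub : Metric.closedBall (0 : ℂ) 1 ⊆
      U ∩ (fun v : ℂ => ‖(v + w) / (1 + conj w * v)‖) ⁻¹' Set.Iio ρ := by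
    intro v hv
    have hv1 : ‖v‖ ≤ 1 := by simpa using hv
    refine ⟨?_, (norm_moebius_le_one hw hv1).trans_lt hρ⟩
    change ‖w‖ * ‖v‖ < 1
    nlinarith [norm_nonneg w, norm_nonneg v]
  obtain ⟨δ, hδ, hδs⟩ := (isCompact_closedBall (0 : ℂ) 1).exists_cthickening_subset_open hV hsub
  rw [cthickening_closedBall hδ.le zero_le_one] at hδs
  refine ⟨δ + 1, by linarith, fun v hv => ?_⟩
  obtain ⟨h1, h2⟩ := hδs (show v ∈ Metric.closedBall (0 : ℂ) (δ + 1) by simpa using hv)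
  exact ⟨h1, le_of_lt h2⟩

theorem differentiableOn_moebius_pow (p : ℕ) {w : ℂ} {s : Set ℂ}
    (hs : ∀ v ∈ s, ‖w‖ * ‖v‖ < 1) :
    DifferentiableOn ℂ (fun v : ℂ => ((v + w) / (1 + conj w * v)) ^ p) s :=
  (DifferentiableOn.div (by fun_prop) (by fun_prop)
    fun v hv => one_add_conj_mul_ne_zero (hs v hv)).pow p

theorem hasSum_scatteringPoly_mul_pow (p : ℕ) {w v : ℂ} (hw : ‖w‖ < 1) (hv : ‖v‖ ≤ 1) :
    HasSum (fun q : ℕ => scatteringPoly p q w * v ^ q)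
      (((v + w) / (1 + conj w * v)) ^ p) := by
  obtain ⟨R, hR, hRw⟩ := exists_radius_norm_moebius_le hw one_lt_two
  have h := Complex.hasSum_taylorSeries_on_ball
    (differentiableOn_moebius_pow p (w := w) (s := Metric.ball 0 R)
      fun v hv => (hRw v (by simpa using (Metric.mem_ball.mp hv).le)).1)
    (show v ∈ Metric.ball (0 : ℂ) R by simpa using hv.trans_lt hR)
  refine h.congr_fun fun q => ?_
  have h3 : (q.factorial : ℂ) ≠ 0 := by exact_mod_cast Nat.factorial_ne_zero _
  rw [iteratedDeriv_moebius_pow p q hw, smul_eq_mul, smul_eq_mul, sub_zero]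
  field_simp

theorem norm_scatteringPoly_le {w : ℂ} (hw : ‖w‖ < 1) {ρ : ℝ} (hρ : 1 < ρ) :
    ∃ R : ℝ, 1 < R ∧ ∀ p q : ℕ, ‖scatteringPoly p q w‖ ≤ ρ ^ p / R ^ q := by
  obtain ⟨R, hR, hRw⟩ := exists_radius_norm_moebius_le hw hρ
  refine ⟨R, hR, fun p q => ?_⟩
  have hdiff := differentiableOn_moebius_pow p (w := w) (s := Metric.closedBall 0 R)
      fun v hv => (hRw v (by simpa using hv)).1
  have h := Complex.norm_iteratedDeriv_le_of_forall_mem_sphere_norm_le (C := ρ ^ p) q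
    (zero_lt_one.trans hR) (hdiff.diffContOnCl_ball subset_rfl) fun v hv => by
      rw [norm_pow]
      exact pow_le_pow_left₀ (norm_nonneg _) (hRw v (by simpa using (Metric.mem_sphere.mp hv).le)).2 p
  rw [iteratedDeriv_moebius_pow p q hw, norm_mul, Complex.norm_natCast, mul_div_assoc] at h
  exact le_of_mul_le_mul_left h (by positivity)

theorem scatteringPoly_succ_right_of_norm_eq_one (p q : ℕ) {w : ℂ} (hw : ‖w‖ = 1) :
    scatteringPoly p ((q + 1 : ℕ) : ℤ) w = 0 := by
  rcases p with _ | p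
  · exact scatteringPoly_zero_succ q w
  · exact scatteringPoly_succ_succ_of_norm_eq_one p q hw

/-! ### Expansion and summability for one coordinate, boundary case included. -/

theorem diskMap_of_norm_eq_one {w : ℂ} (z : Circle) (v : ℂ) (hw : ‖w‖ = 1) :
    diskMap w z v = (z : ℂ) * w :=
  if_pos hw

theorem diskMap_of_norm_ne_one {w : ℂ} (z : Circle) (v : ℂ) (hw : ‖w‖ ≠ 1) :
    diskMap w z v = (z : ℂ) * ((v + w) / (1 + conj w * v)) :=
  if_neg hw

theorem hasSum_diskMap_pow (p : ℕ) {w v : ℂ} (z : Circle) (hw : ‖w‖ ≤ 1) (hv : ‖v‖ ≤ 1) :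
    HasSum (fun q : ℕ => scatteringPoly p q w * (z : ℂ) ^ p * v ^ q) (diskMap w z v ^ p) := by
  rcases hw.lt_or_eq with hw | hw
  · rw [diskMap_of_norm_ne_one _ _ hw.ne, mul_pow, mul_comm]
    exact ((hasSum_scatteringPoly_mul_pow p hw hv).mul_right _).congr_fun fun q => by ring
  -- On the boundary the factor `1 - |w|²` kills every term with `q ≥ 1`, matching the constant map.
  · rw [diskMap_of_norm_eq_one _ _ hw]
    have h0 := scatteringPoly_zero_right p w
    have h := hasSum_single (f := fun q : ℕ => scatteringPoly p q w * (z : ℂ) ^ p * v ^ q) 0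
      fun q hq => by
        obtain ⟨q, rfl⟩ := Nat.exists_eq_succ_of_ne_zero hq
        have := scatteringPoly_succ_right_of_norm_eq_one p q hw
        simp only [Nat.succ_eq_add_one, this, zero_mul]
    simpa only [Nat.cast_zero, h0, pow_zero, mul_one, mul_pow, mul_comm] using h

theorem norm_diskMap_le_one {w v : ℂ} (z : Circle) (hw : ‖w‖ ≤ 1) (hv : ‖v‖ ≤ 1) :
    ‖diskMap w z v‖ ≤ 1 := by
  rcases hw.lt_or_eq with hw | hw
  · rw [diskMap_of_norm_ne_one _ _ hw.ne, norm_mul, Circle.norm_coe, one_mul]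
    exact norm_moebius_le_one hw hv
  · rw [diskMap_of_norm_eq_one _ _ hw, norm_mul, Circle.norm_coe, one_mul, hw]

theorem summable_norm_scatteringPoly_mul_pow {w : ℂ} (hw : ‖w‖ ≤ 1) {ρ : ℝ} (hρ : 1 < ρ) :
    ∃ s : ℝ, 1 < s ∧ ∃ C : ℝ, ∀ p : ℕ,
      Summable (fun q : ℕ => ‖scatteringPoly p q w‖ * s ^ q) ∧
        ∑' q : ℕ, ‖scatteringPoly p q w‖ * s ^ q ≤ C * ρ ^ p := by
  rcases hw.lt_or_eq with hw | hw
  · obtain ⟨R, hR, h⟩ := norm_scatteringPoly_le hw hρ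
    obtain ⟨s, hs, hsR⟩ := exists_between hR
    have hR0 : 0 < R := by linarith
    have hs0 : 0 < s := by linarith
    refine ⟨s, hs, (1 - s / R)⁻¹, fun p => ?_⟩
    have hg := (hasSum_geometric_of_lt_one (by positivity)
      ((div_lt_one hR0).mpr hsR)).mul_right (ρ ^ p)
    have hle : ∀ q : ℕ, ‖scatteringPoly p q w‖ * s ^ q ≤ (s / R) ^ q * ρ ^ p := fun q => by
      refine (mul_le_mul_of_nonneg_right (h p q) (by positivity)).trans_eq ?_
      rw [div_pow]
      ring
    have hsum := Summable.of_nonneg_of_le (fun q => by positivity) hle hg.summable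
    exact ⟨hsum, hasSum_le hle hsum.hasSum hg⟩
  · refine ⟨2, one_lt_two, 1, fun p => ?_⟩
    have hs : HasSum (fun q : ℕ => ‖scatteringPoly p q w‖ * 2 ^ q) 1 := by
      have h0 := scatteringPoly_zero_right p w
      have h := hasSum_single (f := fun q : ℕ => ‖scatteringPoly p q w‖ * 2 ^ q) 0
        fun q hq => by
          obtain ⟨q, rfl⟩ := Nat.exists_eq_succ_of_ne_zero hq
          have := scatteringPoly_succ_right_of_norm_eq_one p q hw
          simp only [Nat.succ_eq_add_one, this, norm_zero, zero_mul]
      simpa only [Nat.cast_zero, h0, norm_pow, hw, one_pow, pow_zero, mul_one] using h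
    refine ⟨hs.summable, ?_⟩
    rw [hs.tsum_eq, one_mul]
    exact one_le_pow₀ hρ.le

/-! ### Induction on the number of coordinates. -/

theorem scatteringProd_natCast_cons {n : ℕ} (w : Fin (n + 2) → ℂ) (p : ℕ)
    (k : Fin (n + 1) → ℕ) :
    scatteringProd w (fun j => ((Fin.cons p k : Fin (n + 2) → ℕ) j : ℤ)) =
      scatteringPoly p (k 0) (w 0) * scatteringProd (Fin.tail w) (fun j => (k j : ℤ)) := by
  rw [scatteringProd, Fin.prod_univ_succ, scatteringProd]
  congr 1
  refine Finset.prod_congr rfl fun j _ => ?_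
  have : nextEntry (fun j => ((Fin.cons p k : Fin (n + 2) → ℕ) j : ℤ)) j.succ =
      nextEntry (fun j => (k j : ℤ)) j := by
    by_cases h : (j : ℕ) + 1 < n + 1
    · have h' : (j.succ : ℕ) + 1 < n + 2 := by simpa using h
      rw [nextEntry, nextEntry, dif_pos h, dif_pos h']
      rfl
    · have h' : ¬ (j.succ : ℕ) + 1 < n + 2 := by simpa using h
      rw [nextEntry, nextEntry, dif_neg h, dif_neg h']
  rw [this]
  rfl

theorem scatteringProd_one (w : Fin 1 → ℂ) (p : ℕ) (k : Fin 0 → ℕ) :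
    scatteringProd w (fun j => ((Fin.cons p k : Fin 1 → ℕ) j : ℤ)) = w 0 ^ p := by
  simp [scatteringProd, nextEntry, scatteringPoly_zero_right]

/-- The growth rate `ρ` is arbitrary so that the tail can be bounded by `C₂ * s ^ q`, with `s` the
weight under which the first coordinate is still summable. -/
theorem summable_norm_scatteringProd {n : ℕ} (w : Fin (n + 1) → ℂ) (hw : ∀ j, ‖w j‖ ≤ 1)
    {ρ : ℝ} (hρ : 1 < ρ) : ∃ C : ℝ, ∀ p : ℕ,
      Summable (fun k : Fin n → ℕ =>
        ‖scatteringProd w (fun j => ((Fin.cons p k : Fin (n + 1) → ℕ) j : ℤ))‖) ∧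
      ∑' k : Fin n → ℕ,
        ‖scatteringProd w (fun j => ((Fin.cons p k : Fin (n + 1) → ℕ) j : ℤ))‖ ≤ C * ρ ^ p := by
  induction n generalizing ρ with
  | zero =>
    refine ⟨1, fun p => ⟨Summable.of_finite, ?_⟩⟩
    rw [tsum_fintype]
    simp only [scatteringProd_one, Finset.univ_unique, Finset.sum_const, Finset.card_singleton,
      one_smul, norm_pow, one_mul]
    exact pow_le_pow_left₀ (norm_nonneg _) ((hw 0).trans hρ.le) p
  | succ n ih =>
    obtain ⟨s, hs, C₁, h₁⟩ := summable_norm_scatteringPoly_mul_pow (hw 0) hρ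
    obtain ⟨C₂, h₂⟩ := ih (Fin.tail w) (fun j => hw j.succ) hs
    have hC₂ : 0 ≤ C₂ := by
      have := (tsum_nonneg fun _ => norm_nonneg _).trans (h₂ 0).2
      simpa using this
    refine ⟨C₂ * C₁, fun p => ?_⟩
    set F : ℕ × (Fin n → ℕ) → ℝ := fun x => ‖scatteringPoly p x.1 (w 0)‖ *
      ‖scatteringProd (Fin.tail w) (fun j => ((Fin.cons x.1 x.2 : Fin (n + 1) → ℕ) j : ℤ))‖
      with hF
    have hcomp : (fun k : Fin (n + 1) → ℕ =>
        ‖scatteringProd w (fun j => ((Fin.cons p k : Fin (n + 2) → ℕ) j : ℤ))‖) ∘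
          (Fin.consEquiv fun _ => ℕ) = F := by
      funext x
      rw [Function.comp_apply, scatteringProd_natCast_cons, norm_mul]
      rfl
    have hle : ∀ q : ℕ, ∑' k, F (q, k) ≤ C₂ * (‖scatteringPoly p q (w 0)‖ * s ^ q) := fun q => by
      simp only [hF, tsum_mul_left]
      refine (mul_le_mul_of_nonneg_left (h₂ q).2 (norm_nonneg _)).trans_eq ?_
      ring
    have hsum' : Summable fun q => ∑' k, F (q, k) :=
      Summable.of_nonneg_of_le (fun q => tsum_nonneg fun k => by positivity) hle
        ((h₁ p).1.mul_left C₂)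
    have hsum : Summable F := (summable_prod_of_nonneg fun x => by positivity).mpr
      ⟨fun q => by simpa only [hF] using (h₂ q).1.mul_left ‖scatteringPoly p q (w 0)‖, hsum'⟩
    refine ⟨(Fin.consEquiv fun _ => ℕ).summable_iff.mp (by rw [hcomp]; exact hsum), ?_⟩
    have htsum := (Fin.consEquiv fun _ : Fin (n + 1) => ℕ).tsum_eq fun k : Fin (n + 1) → ℕ =>
        ‖scatteringProd w (fun j => ((Fin.cons p k : Fin (n + 2) → ℕ) j : ℤ))‖
    refine htsum.symm.trans_le ((tsum_congr (congrFun hcomp)).trans_le ?_)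
    rw [hsum.tsum_prod, mul_assoc]
    refine (hsum'.tsum_le_tsum hle ((h₁ p).1.mul_left C₂)).trans ?_
    rw [tsum_mul_left]
    exact mul_le_mul_of_nonneg_left (h₁ p).2 hC₂

theorem diskComp_succ {n : ℕ} (w : Fin (n + 1) → ℂ) (z : Fin (n + 1) → Circle) :
    diskComp w z = diskMap (w 0) (z 0) (diskComp (Fin.tail w) (Fin.tail z)) := by
  rw [diskComp, List.ofFn_succ]
  rfl

theorem norm_diskComp_le_one {n : ℕ} (w : Fin n → ℂ) (hw : ∀ j, ‖w j‖ ≤ 1)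
    (z : Fin n → Circle) : ‖diskComp w z‖ ≤ 1 := by
  induction n with
  | zero => simp [diskComp]
  | succ n ih =>
    rw [diskComp_succ]
    exact norm_diskMap_le_one _ (hw 0) (ih _ (fun j => hw j.succ) _)

theorem norm_prod_coe_circle_zpow {n : ℕ} (z : Fin n → Circle) (k : Fin n → ℤ) :
    ‖∏ j, (z j : ℂ) ^ k j‖ = 1 := by
  simp [norm_prod, Circle.norm_coe]

theorem hasSum_scatteringProd_cons {n : ℕ} (w : Fin (n + 1) → ℂ) (hw : ∀ j, ‖w j‖ ≤ 1)
    (z : Fin (n + 1) → Circle) (p : ℕ) :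
    HasSum (fun k : Fin n → ℕ =>
      scatteringProd w (fun j => ((Fin.cons p k : Fin (n + 1) → ℕ) j : ℤ)) *
        ∏ j, (z j : ℂ) ^ ((Fin.cons p k : Fin (n + 1) → ℕ) j : ℤ)) (diskComp w z ^ p) := by
  induction n generalizing p with
  | zero =>
    have h := hasSum_unique fun k : Fin 0 → ℕ =>
      scatteringProd w (fun j => ((Fin.cons p k : Fin 1 → ℕ) j : ℤ)) *
        ∏ j, (z j : ℂ) ^ ((Fin.cons p k : Fin 1 → ℕ) j : ℤ)
    have h0 : diskMap (w 0) (z 0) 0 = (z 0 : ℂ) * w 0 := by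
      by_cases h1 : ‖w 0‖ = 1
      · exact diskMap_of_norm_eq_one _ _ h1
      · simp [diskMap_of_norm_ne_one _ _ h1]
    have h1 : diskComp w z ^ p = w 0 ^ p * (z 0 : ℂ) ^ p := by
      rw [diskComp_succ, ← mul_pow, mul_comm (w 0), ← h0]
      rfl
    rw [scatteringProd_one, Fin.prod_univ_one, Fin.cons_zero, zpow_natCast] at h
    rw [h1]
    exact h
  | succ n ih =>
    set G : (Fin (n + 1) → ℕ) → ℂ := fun k =>
      scatteringProd w (fun j => ((Fin.cons p k : Fin (n + 2) → ℕ) j : ℤ)) *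
        ∏ j, (z j : ℂ) ^ ((Fin.cons p k : Fin (n + 2) → ℕ) j : ℤ) with hG
    have hsum : Summable G := by
      obtain ⟨C, hC⟩ := summable_norm_scatteringProd w hw one_lt_two
      refine Summable.of_norm ((hC p).1.congr fun k => ?_)
      rw [norm_mul, norm_prod_coe_circle_zpow, mul_one]
    have hsum' : Summable (G ∘ Fin.consEquiv fun _ => ℕ) :=
      (Fin.consEquiv fun _ => ℕ).summable_iff.mpr hsum
    have hfib : ∀ q : ℕ, HasSum (fun k => (G ∘ Fin.consEquiv fun _ => ℕ) (q, k))
        (scatteringPoly p q (w 0) * (z 0 : ℂ) ^ p *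
          diskComp (Fin.tail w) (Fin.tail z) ^ q) := fun q => by
      refine ((ih (Fin.tail w) (fun j => hw j.succ) (Fin.tail z) q).mul_left
        (scatteringPoly p q (w 0) * (z 0 : ℂ) ^ p)).congr_fun fun k => ?_
      change G (Fin.cons q k) = _
      simp only [hG]
      rw [scatteringProd_natCast_cons, Fin.prod_univ_succ]
      simp only [Fin.cons_zero, Fin.cons_succ, zpow_natCast, Fin.tail]
      ring
    -- Both sums below run over `q`: uniqueness of limits identifies the total with the
    -- one-coordinate expansion.
    have h1 := hsum'.hasSum.prod_fiberwise hfib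
    have h2 := h1.unique (hasSum_diskMap_pow p (z 0) (hw 0)
      (norm_diskComp_le_one (Fin.tail w) (fun j => hw j.succ) (Fin.tail z)))
    rw [diskComp_succ, ← h2]
    exact (Fin.consEquiv fun _ => ℕ).hasSum_iff.mp hsum'.hasSum

/-- The lattice `{1} × ℤ_+^n` is parametrized by `ℕ^n`. -/
def latticeIndexEquiv (n : ℕ) : (Fin n → ℕ) ≃ latticeIndex (n + 1) where
  toFun k := ⟨fun j => ((Fin.cons 1 k : Fin (n + 1) → ℕ) j : ℤ),
    by simp, fun j => Int.natCast_nonneg _⟩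
  invFun k j := (k.1 j.succ).toNat
  left_inv k := by
    funext j
    simp
  right_inv k := by
    apply Subtype.ext
    funext j
    refine Fin.cases ?_ (fun i => ?_) j
    · simpa using k.2.1.symm
    · simpa using k.2.2 i.succ

theorem hasSum_latticeIndex {n : ℕ} (w : Fin (n + 1) → ℂ) (hw : ∀ j, ‖w j‖ ≤ 1)
    (z : Fin (n + 1) → Circle) :
    HasSum (fun k : latticeIndex (n + 1) => scatteringProd w k.1 * ∏ j, (z j : ℂ) ^ (k.1 j))
      (diskComp w z) := by
  rw [← (latticeIndexEquiv n).hasSum_iff]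
  simpa only [pow_one] using! hasSum_scatteringProd_cons w hw z 1

theorem summable_norm_latticeIndex {n : ℕ} (w : Fin (n + 1) → ℂ) (hw : ∀ j, ‖w j‖ ≤ 1) :
    Summable (fun k : latticeIndex (n + 1) => ‖scatteringProd w k.1‖) := by
  rw [← (latticeIndexEquiv n).summable_iff]
  obtain ⟨C, hC⟩ := summable_norm_scatteringProd w hw one_lt_two
  exact (hC 1).1

/-! ### Fourier coefficients of uniformly convergent series. -/

noncomputable section Fourier

/-- The measure on `ℝ / ℤ` of total mass one, as in the theory of `UnitAddTorus.mFourierCoeff`. -/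
local instance : MeasureTheory.MeasureSpace UnitAddCircle := ⟨AddCircle.haarAddCircle⟩

local instance :
    MeasureTheory.IsProbabilityMeasure (MeasureTheory.volume : MeasureTheory.Measure UnitAddCircle) :=
  inferInstanceAs (MeasureTheory.IsProbabilityMeasure AddCircle.haarAddCircle)

/-- Sup-norm convergence passes to `L²`, where the coefficient is a continuous functional, the inner
product with a character; orthonormality evaluates it termwise. -/
theorem hasSum_mFourierCoeff {d ι : Type*} [Fintype d] {c : ι → ℂ} {e : ι → d → ℤ}
    {f : C(UnitAddTorus d, ℂ)}
    (hf : HasSum (fun i => c i • UnitAddTorus.mFourier (e i)) f) (k : d → ℤ) [DecidableEq (d → ℤ)] :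
    HasSum (fun i => if k = e i then c i else 0) (UnitAddTorus.mFourierCoeff f k) := by
  have h1 := (innerSL ℂ (UnitAddTorus.mFourierLp (d := d) 2 k)).hasSum
    ((ContinuousMap.toLp (E := ℂ) 2 MeasureTheory.volume ℂ).hasSum hf)
  have h2 : innerSL ℂ (UnitAddTorus.mFourierLp (d := d) 2 k)
      (ContinuousMap.toLp (E := ℂ) 2 MeasureTheory.volume ℂ f) =
      UnitAddTorus.mFourierCoeff f k := by
    rw [← UnitAddTorus.mFourierCoeff_toLp, ← UnitAddTorus.mFourierBasis_repr,
      HilbertBasis.repr_apply_apply, UnitAddTorus.coe_mFourierBasis]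
    rfl
  rw [h2] at h1
  refine h1.congr_fun fun i => ?_
  have h3 := orthonormal_iff_ite.mp (UnitAddTorus.orthonormal_mFourier (d := d)) k (e i)
  simp [h3]

end Fourier

end Scattering

theorem mainTheorem1 (n : ℕ) [NeZero n] (w : Fin n → ℂ) (hw : ∀ j, ‖w j‖ ≤ 1) :
    Continuous (Scattering.diskCompTorus w) ∧
    (∀ k ∈ Scattering.latticeIndex n,
      UnitAddTorus.mFourierCoeff (Scattering.diskCompTorus w) k = Scattering.scatteringProd w k) ∧
    (∀ k ∉ Scattering.latticeIndex n,
      UnitAddTorus.mFourierCoeff (Scattering.diskCompTorus w) k = 0) ∧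
    (∀ z : Fin n → Circle,
      HasSum
        (fun k : Scattering.latticeIndex n =>
          Scattering.scatteringProd w k.1 * ∏ j, (z j : ℂ) ^ (k.1 j))
        (Scattering.diskComp w z)) := by
  classical
  obtain ⟨n, rfl⟩ := Nat.exists_eq_succ_of_ne_zero (NeZero.ne n)
  have hseries := Scattering.hasSum_latticeIndex w hw
  have hsum : Summable fun k : Scattering.latticeIndex (n + 1) =>
      Scattering.scatteringProd w k.1 • UnitAddTorus.mFourier k.1 :=
    Summable.of_norm ((Scattering.summable_norm_latticeIndex w hw).congr fun k => by
      rw [norm_smul, UnitAddTorus.mFourier_norm, mul_one])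
  obtain ⟨f, hf⟩ := hsum
  have hfeq : Scattering.diskCompTorus w = f := by
    funext t
    -- Evaluation is continuous, so the uniform sum agrees with the pointwise one.
    have h1 := (ContinuousMap.evalCLM ℂ t).hasSum hf
    refine (hseries fun j => AddCircle.toCircle (t j)).unique (h1.congr_fun fun k => ?_)
    simp [UnitAddTorus.mFourier, fourier_apply, AddCircle.toCircle_zsmul]
  rw [hfeq]
  refine ⟨f.continuous, fun k hk => ?_, fun k hk => ?_, hseries⟩
  · refine (Scattering.hasSum_mFourierCoeff hf k).unique ?_
    have h := hasSum_single (f := fun i : Scattering.latticeIndex (n + 1) =>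
      if k = i.1 then Scattering.scatteringProd w i.1 else 0) ⟨k, hk⟩
      fun i hi => if_neg fun h => hi (Subtype.ext h.symm)
    rwa [if_pos rfl] at h
  · refine (Scattering.hasSum_mFourierCoeff hf k).unique ?_
    have h : (fun i : Scattering.latticeIndex (n + 1) =>
        if k = i.1 then Scattering.scatteringProd w i.1 else 0) = fun _ => 0 :=
      funext fun i => if_neg fun h => hk (by rw [h]; exact i.2)
    rw [h]
    exact hasSum_zero
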